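/- Let $k\ge 1$ and $d\ge 0$ be integers with $d+1\le k$, and put $\alpha=\frac{d+1}{k}\in(0,1]$. For a prime $q$, a set $X\subseteq\mathbb F_q$ with $|X|=k$, and permutations $\pi=(\pi_x)_{x\in X}$ of $\mathbb F_q$, let $\Omega=X\times\mathbb F_q$, let $n=|\Omega|=kq$, and let $\mu_\pi$ be the uniform distribution on the $k$-element sets $\{(x,y_x):x\in X\}\subseteq\Omega$ for which some polynomial $p\in\mathbb F_q[z]$ of degree at most $d$ satisfies $p(x)=\pi_x(y_x)$ for all $x\in X$. **Definitions.** For a distribution $\mu$ on $\binom{\Omega}{k}$ and $\ell\le k$, let $\mu D_{k\to\ell}$ be the law of a uniformly random $\ell$-element subset of a random $S\sim\mu$. For $\alpha\in(0,1]$, $\mu$ is *$(1/\alpha)$-entropically independent* if $\mathcal D_{\mathrm{KL}}(\nu D_{k\to1}\,\|\,\mu D_{k\to1})\le\frac1{\alpha k}\mathcal D_{\mathrm{KL}}(\nu\,\|\,\mu)$ for all probability distributions $\nu$ on $\binom{\Omega}{k}$. For $\lambda\in\mathbb R_{\ge0}^{\Omega}$, the external field $\lambda\star\mu$ is the distribution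 with $(\lambda\star\mu)(S)\propto\mu(S)\prod_{i\in S}\lambda_i$; if all these weights vanish, sampling from $\lambda\star\mu$ fails (a special outcome outside $\binom{\Omega}{k}$). A *domain sparsification scheme* on $\Omega$ with access to marginals of order at most $m$ is a randomized procedure, with no restriction on its running time, that is given the numbers $\mathbb P_{S\sim\mu}[T\subseteq S]$ for all $T\subseteq\Omega$ with $|T|\le m$ and arbitrarily many independent samples from each $\mu D_{k\to\ell}$, $\ell\le m$, but has no other information on $\mu$, and outputs a random $\lambda\in\mathbb R_{\ge0}^{\Omega}$. It *sparsifies $\mu$ to size $t$ with accuracy $\varepsilon$* if almost surely $\lambda$ has at most $t$ nonzero entries and the outcome of drawing $\lambda$ and then sampling from $\lambda\star\mu$ is within total variation distance $\varepsilon$ of $\mu$. **Lemma.** 1. For all $q$, $X$ and $\pi$ as above, $\mu_\pi$ is $(1/\alpha)$-entropically independent. 2. For all $\varepsilon<1$ and $\delta>0$ there is a constant $c>0$, depending only on $k,d,\varepsilon,\delta$, such that for all $q$ and $X$ as above, all integers $t\ge0$, and every domain sparsification scheme on $\Omega$ with access to marginals of order at most $d+1$: if the $\pi_x$ ($x\in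 X$) are independent uniformly random permutations of $\mathbb F_q$, and with probability at least $\delta$ over $\pi$ the scheme sparsifies $\mu_\pi$ to size $t$ with accuracy $\varepsilon$, then $t\ge c\,n^{1-\alpha}$. In particular, $t=\tilde\Omega(n^{1-\alpha})$ is required. -/

import Mathlib

open MeasureTheory ProbabilityTheory
open scoped ENNReal NNReal

/-- The family of `k`-element subsets of the ground set `Ω`. -/
abbrev KSet (Ω : Type*) (k : ℕ) : Type _ := {S : Finset Ω // S.card = k}

/-! ### The down operator and entropic independence -/

theorem KSet.subsets_nonempty {Ω : Type*} [Fintype Ω] [DecidableEq Ω] {k l : ℕ} (h : l ≤ k)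
    (S : KSet Ω k) : (Finset.univ.filter fun T : KSet Ω l => T.1 ⊆ S.1).Nonempty := by
  obtain ⟨T, hT, hc⟩ := Finset.exists_subset_card_eq (h.trans_eq S.2.symm)
  exact ⟨⟨T, hc⟩, by simpa using hT⟩

/-- The row of the down operator `D_{k → l}` at `S`: the uniform distribution on the
`l`-element subsets of `S`. -/
noncomputable def downRow {Ω : Type*} [Fintype Ω] [DecidableEq Ω] {k l : ℕ} (h : l ≤ k)
    (S : KSet Ω k) : PMF (KSet Ω l) :=
  PMF.uniformOfFinset (Finset.univ.filter fun T : KSet Ω l => T.1 ⊆ S.1)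
    (KSet.subsets_nonempty h S)

/-- The distribution `μ D_{k → l}` on `l`-element sets. -/
noncomputable def downLaw {Ω : Type*} [Fintype Ω] [DecidableEq Ω] {k l : ℕ} (h : l ≤ k)
    (μ : PMF (KSet Ω k)) : PMF (KSet Ω l) :=
  μ.bind (downRow h)

/-- `μ` is `(1/α)`-entropically independent, `α ∈ (0, 1]`: for every distribution `ν` on
`k`-element sets, `KL(ν D_{k → 1} ‖ μ D_{k → 1}) ≤ (1 / (α k)) KL(ν ‖ μ)`
(both sides in `[0, ∞]`). -/
def EntropicallyIndependent {Ω : Type*} [Fintype Ω] [DecidableEq Ω] {k : ℕ} (hk : 1 ≤ k)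
    (α : ℝ) (μ : PMF (KSet Ω k)) : Prop :=
  0 < α ∧ α ≤ 1 ∧ ∀ ν : PMF (KSet Ω k),
    InformationTheory.klDiv (downLaw hk ν).toMeasure (downLaw hk μ).toMeasure ≤
      ENNReal.ofReal (1 / (α * k)) * InformationTheory.klDiv ν.toMeasure μ.toMeasure

/-! ### External fields -/

/-- The unnormalized weight `μ(S) ∏_{i ∈ S} w_i`. -/
noncomputable def fieldWeight {Ω : Type*} {k : ℕ} (μ : PMF (KSet Ω k)) (w : Ω → ℝ≥0)
    (S : KSet Ω k) : ℝ≥0∞ :=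
  μ S * ∏ i ∈ S.1, (w i : ℝ≥0∞)

theorem tsum_fieldWeight_ne_top {Ω : Type*} [Fintype Ω] {k : ℕ} (μ : PMF (KSet Ω k))
    (w : Ω → ℝ≥0) : ∑' S, fieldWeight μ w S ≠ ∞ := by
  rw [tsum_fintype]
  refine ENNReal.sum_ne_top.2 fun S _ => ENNReal.mul_ne_top (μ.apply_ne_top S) ?_
  exact ENNReal.prod_ne_top fun i _ => ENNReal.coe_ne_top

open scoped Classical in
/-- The result of sampling from the external field `w ⋆ μ`, where `(w ⋆ μ)(S)` is proportional to
`μ(S) ∏_{i ∈ S} w_i`.  If all these weights vanish, then `w ⋆ μ` does not exist and the sampling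
fails, with outcome `none`. -/
noncomputable def fieldSample {Ω : Type*} [Fintype Ω] {k : ℕ} (μ : PMF (KSet Ω k))
    (w : Ω → ℝ≥0) : PMF (Option (KSet Ω k)) :=
  if h : ∑' S, fieldWeight μ w S = 0 then PMF.pure none
  else (PMF.normalize (fieldWeight μ w) h (tsum_fieldWeight_ne_top μ w)).map some

/-! ### Domain sparsification schemes with access to marginals of order at most `m` -/

/-- A table with one number for every set of size at most `m`. -/
abbrev MarginalTable (Ω : Type*) (m : ℕ) : Type _ := {T : Finset Ω // T.card ≤ m} → ℝ≥0∞

/-- The marginals of `μ` of all orders at most `m`: the numbers `P_{S ∼ μ}[T ⊆ S]`. -/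
noncomputable def marginals {Ω : Type*} {k : ℕ} (m : ℕ) (μ : PMF (KSet Ω k)) :
    MarginalTable Ω m :=
  fun T => μ.toOuterMeasure {S | T.1 ⊆ S.1}

/-- For every order `l ≤ m`, an infinite sequence of `l`-element sets; the entry at `(j, l)` is the
`j`-th of them. -/
abbrev MarginalSamples (Ω : Type*) (m : ℕ) : Type _ := (i : ℕ × Fin (m + 1)) → KSet Ω i.2

/-- The law of the answers of the sampling oracles: all samples are independent, and those of order
`l ≤ m` have law `μ D_{k → l}`. -/
noncomputable def marginalSamplesLaw {Ω : Type*} [Fintype Ω] [DecidableEq Ω] {k m : ℕ}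
    (hm : m ≤ k) (μ : PMF (KSet Ω k)) : Measure (MarginalSamples Ω m) :=
  Measure.infinitePi fun i : ℕ × Fin (m + 1) =>
    (downLaw ((Nat.lt_succ_iff.1 i.2.2).trans hm) μ).toMeasure

/-- A (randomized) domain sparsification scheme with access to marginals of order at most `m`: it
sees the exact values of the marginals and as many independent samples from them as it likes, may
toss coins of its own (hence a Markov kernel), and outputs an external field. -/
structure SparsificationScheme (Ω : Type*) (m : ℕ) where
  /-- The law of the output, given the marginals and the samples. -/
  kernel : MarginalTable Ω m → Kernel (MarginalSamples Ω m) (Ω → ℝ≥0)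
  /-- For every table and samples, the law of the output is a probability measure. -/
  isMarkov : ∀ table, IsMarkovKernel (kernel table)

namespace SparsificationScheme

/-- The law of the random external field that the scheme outputs when run on `μ`. -/
noncomputable def fieldLaw {Ω : Type*} [Fintype Ω] [DecidableEq Ω] {k m : ℕ}
    (A : SparsificationScheme Ω m) (hm : m ≤ k) (μ : PMF (KSet Ω k)) : Measure (Ω → ℝ≥0) :=
  (marginalSamplesLaw hm μ).bind (A.kernel (marginals m μ))

/-- The probability of the outcome `o` when first `w` is drawn by the scheme run on `μ`, and then a
sample of `w ⋆ μ` is drawn. -/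
noncomputable def outputProb {Ω : Type*} [Fintype Ω] [DecidableEq Ω] {k m : ℕ}
    (A : SparsificationScheme Ω m) (hm : m ≤ k) (μ : PMF (KSet Ω k)) (o : Option (KSet Ω k)) :
    ℝ≥0∞ :=
  ∫⁻ w, fieldSample μ w o ∂(A.fieldLaw hm μ)

/-- The total variation distance between the output of the scheme run on `μ` and `μ` itself. -/
noncomputable def tvError {Ω : Type*} [Fintype Ω] [DecidableEq Ω] {k m : ℕ}
    (A : SparsificationScheme Ω m) (hm : m ≤ k) (μ : PMF (KSet Ω k)) : ℝ :=
  (1 / 2) * ∑ o : Option (KSet Ω k), |(A.outputProb hm μ o).toReal - ((μ.map some) o).toReal|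

/-- The scheme sparsifies the domain of `μ` to size `t` with accuracy `ε`: its external field has
at most `t` nonzero entries, and a sample of this field applied to `μ` is within total variation
distance `ε` of `μ`. -/
def Sparsifies {Ω : Type*} [Fintype Ω] [DecidableEq Ω] {k m : ℕ}
    (A : SparsificationScheme Ω m) (hm : m ≤ k) (μ : PMF (KSet Ω k)) (t : ℕ) (ε : ℝ) : Prop :=
  (∀ᵐ w ∂(A.fieldLaw hm μ), (Finset.univ.filter fun i => w i ≠ 0).card ≤ t) ∧
    A.tvError hm μ ≤ ε

end SparsificationScheme

/-! ### The permuted Reed-Solomon distribution -/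

/-- The ground set `X × F_q` for a set `X` of evaluation points. -/
abbrev RSGround {q : ℕ} (X : Finset (ZMod q)) : Type := {x // x ∈ X} × ZMod q

/-- The `k`-element set `{(x, y x) | x ∈ X}`. -/
def rsGraph {q k : ℕ} {X : Finset (ZMod q)} (hX : X.card = k) (y : {x // x ∈ X} → ZMod q) :
    KSet (RSGround X) k :=
  ⟨Finset.univ.map ⟨fun x => (x, y x), fun _ _ h => (Prod.ext_iff.1 h).1⟩, by simp [hX]⟩

open scoped Classical in
/-- The sets `{(x, y x) | x ∈ X}` for which some polynomial `p` of degree at most `d` satisfies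
`p(x) = π_x(y x)` for all `x ∈ X`. -/
noncomputable def rsSupport {q k : ℕ} [NeZero q] (d : ℕ) {X : Finset (ZMod q)} (hX : X.card = k)
    (π : {x // x ∈ X} → Equiv.Perm (ZMod q)) : Finset (KSet (RSGround X) k) :=
  Finset.univ.filter fun S => ∃ (y : {x // x ∈ X} → ZMod q) (p : Polynomial (ZMod q)),
    S = rsGraph hX y ∧ p.degree ≤ d ∧ ∀ x, p.eval x.1 = π x (y x)

theorem rsSupport_nonempty {q k : ℕ} [NeZero q] (d : ℕ) {X : Finset (ZMod q)} (hX : X.card = k)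
    (π : {x // x ∈ X} → Equiv.Perm (ZMod q)) : (rsSupport d hX π).Nonempty := by
  refine ⟨rsGraph hX fun x => (π x).symm 0, ?_⟩
  simp only [rsSupport, Finset.mem_filter, Finset.mem_univ, true_and]
  exact ⟨_, 0, rfl, by simp, by simp⟩

/-- The uniform distribution on the sets in `rsSupport`. -/
noncomputable def rsLaw {q k : ℕ} [NeZero q] (d : ℕ) {X : Finset (ZMod q)} (hX : X.card = k)
    (π : {x // x ∈ X} → Equiv.Perm (ZMod q)) : PMF (KSet (RSGround X) k) :=
  PMF.uniformOfFinset (rsSupport d hX π) (rsSupport_nonempty d hX π)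

/-!
Write `D = d + 1`. By Lagrange interpolation the values of a polynomial of degree at most `d` on
`D` points are arbitrary and determine the polynomial, so the words `(π_x(y_x))_x` form a code of
`q ^ D` elements whose projection to any `D` coordinates is bijective, and which takes all values
on fewer coordinates equally often (`card_rsCode_eqOn`).

*Entropic independence.* Any distribution `ν` that is absolutely continuous with respect to `μ_π`
is concentrated on the code. Since `D` coordinates determine a code word, Gibbs' inequality for
`ν` and the product of its marginals on a set `T` of `D` coordinates shows that the relative
entropies of these marginals (with respect to the uniform distribution) add up to at most
`KL(ν ‖ μ_π)` (`sum_relEntropy_coordMarginal_le`). Some `T` has at least the average relative entropy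
per coordinate, and the average over all `k` coordinates is `KL(ν D_{k → 1} ‖ μ_π D_{k → 1})`.

*Lower bound.* The marginals of order at most `D` do not depend on `π` (`marginals_rsLaw_eq`). They
determine the laws of the samples, so the random field `w` that a scheme outputs has the same law
for all `π` (`SparsificationScheme.fieldLaw_congr`). Accuracy `ε` forces sampling from `w ⋆ μ_π` to
succeed with probability at least `1 - ε`, in which case `w` is nonzero on all of some set in the
support of `μ_π`. A fixed `w` with at most `t` nonzero entries is nonzero on at most `t ^ k` graphs of
words `y`, and `(π_x(y_x))_x` is uniform in `F_q ^ k` for random `π`, so this happens with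
probability at most `t ^ k * q ^ D / q ^ k`. Exchanging the averages over `π` and `w` gives
`δ * (1 - ε) ≤ t ^ k * q ^ D / q ^ k` (`mul_pow_le_of_sparsifies`), which is the claim after taking
`k`-th roots.
-/

/-! ### Relative entropy on finite types -/

theorem PMF.toMeasure_absolutelyContinuous_iff {α : Type*} [Fintype α] [MeasurableSpace α]
    [MeasurableSingletonClass α] {p r : PMF α} :
    p.toMeasure ≪ r.toMeasure ↔ ∀ a, r a = 0 → p a = 0 := by
  constructor
  · intro h a ha
    rw [← PMF.toMeasure_apply_singleton p a (measurableSet_singleton a)]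
    apply h
    rw [PMF.toMeasure_apply_singleton r a (measurableSet_singleton a), ha]
  · intro h s hs
    rw [PMF.toMeasure_apply_fintype, Finset.sum_eq_zero_iff] at hs ⊢
    intro a _
    by_cases has : a ∈ s
    · simpa [has] using h a (by simpa [has] using hs a (Finset.mem_univ a))
    · simp [has]

theorem PMF.klDiv_toMeasure {α : Type*} [Fintype α] [MeasurableSpace α]
    [MeasurableSingletonClass α] {p r : PMF α} (h : ∀ a, r a = 0 → p a = 0) :
    InformationTheory.klDiv p.toMeasure r.toMeasure =
      ENNReal.ofReal (∑ a, (p a).toReal * Real.log ((p a).toReal / (r a).toReal)) := by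
  have hac := PMF.toMeasure_absolutelyContinuous_iff.2 h
  have hne : InformationTheory.klDiv p.toMeasure r.toMeasure ≠ ∞ :=
    InformationTheory.klDiv_ne_top hac .of_finite
  rw [← ENNReal.ofReal_toReal hne,
    InformationTheory.toReal_klDiv_of_measure_eq hac (by simp), PMF.integral_eq_sum]
  congr 1
  refine Finset.sum_congr rfl fun a _ => ?_
  rw [smul_eq_mul]
  by_cases ha : p a = 0
  · simp [ha]
  have hr : r a ≠ 0 := fun hr => ha (h a hr)
  have key : (p.toMeasure.rnDeriv r.toMeasure) a * r a = p a := by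
    have := congrArg (fun m : Measure α => m {a}) (Measure.withDensity_rnDeriv_eq _ _ hac)
    simpa [mul_comm, withDensity_apply _ (measurableSet_singleton a),
      PMF.toMeasure_apply_singleton _ _ (measurableSet_singleton a)] using this
  have hr' : (r a).toReal ≠ 0 := ENNReal.toReal_ne_zero.2 ⟨hr, r.apply_ne_top a⟩
  rw [llr, ← key, ENNReal.toReal_mul, mul_div_cancel_right₀ _ hr']

/-! ### Subadditivity of entropy -/

/-- The marginal of `g` at the coordinate `x`. -/
noncomputable def coordMarginal {ι F : Type*} [Fintype ι] [DecidableEq ι] [Fintype F]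
    [DecidableEq F] (g : (ι → F) → ℝ) (x : ι) (b : F) : ℝ :=
  ∑ y with y x = b, g y

section Entropy

variable {ι F : Type*} [Fintype ι] [DecidableEq ι] [Fintype F] [DecidableEq F] {g : (ι → F) → ℝ}

theorem sum_coordMarginal_mul (g : (ι → F) → ℝ) (x : ι) (f : F → ℝ) :
    ∑ b, coordMarginal g x b * f b = ∑ y, g y * f (y x) := by
  rw [← Finset.sum_fiberwise_of_maps_to (s := Finset.univ) (t := Finset.univ)
    (g := fun y : ι → F => y x)
    (fun _ _ => Finset.mem_univ _)]
  refine Finset.sum_congr rfl fun b _ => ?_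
  rw [coordMarginal, Finset.sum_mul]
  refine Finset.sum_congr rfl fun y hy => ?_
  rw [(Finset.mem_filter.1 hy).2]

theorem coordMarginal_nonneg (h0 : ∀ y, 0 ≤ g y) (x : ι) (b : F) : 0 ≤ coordMarginal g x b :=
  Finset.sum_nonneg fun y _ => h0 y

theorem coordMarginal_pos (h0 : ∀ y, 0 ≤ g y) (x : ι) {y : ι → F} (hy : g y ≠ 0) :
    0 < coordMarginal g x (y x) :=
  ((h0 y).lt_of_ne' hy).trans_le
    (Finset.single_le_sum (f := g) (fun z _ => h0 z) (Finset.mem_filter.2 ⟨Finset.mem_univ y, rfl⟩))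

/-- If the coordinates in `T` determine every point of the support of `g`, then the product of the
marginals on `T` is a subprobability on that support. -/
theorem sum_prod_coordMarginal_le_one (h0 : ∀ y, 0 ≤ g y) (h1 : ∑ y, g y = 1) {T : Finset ι}
    (hT : ∀ y z, g y ≠ 0 → g z ≠ 0 → (∀ x ∈ T, y x = z x) → y = z) :
    ∑ y with g y ≠ 0, ∏ x ∈ T, coordMarginal g x (y x) ≤ 1 := by
  have hinj : Set.InjOn (fun (y : ι → F) (x : T) => y x)
      (Finset.univ.filter fun y => g y ≠ 0) := by
    intro y hy z hz hyz
    refine hT y z (by simpa using hy) (by simpa using hz) fun x hx => congrFun hyz ⟨x, hx⟩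
  have h2 : ∏ x : T, ∑ b, coordMarginal g x b = 1 := by
    refine Finset.prod_eq_one fun x _ => ?_
    simpa [h1] using sum_coordMarginal_mul g x (fun _ => 1)
  rw [Finset.prod_univ_sum, Fintype.piFinset_univ] at h2
  rw [← h2]
  calc ∑ y with g y ≠ 0, ∏ x ∈ T, coordMarginal g x (y x)
      = ∑ y with g y ≠ 0, ∏ x : T, coordMarginal g x (y x) :=
        Finset.sum_congr rfl fun y _ => (Finset.prod_coe_sort T _).symm
    _ = ∑ z ∈ (Finset.univ.filter fun y => g y ≠ 0).image fun (y : ι → F) (x : T) => y x,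
          ∏ x : T, coordMarginal g x (z x) :=
        (Finset.sum_image (f := fun z : T → F => ∏ x : T, coordMarginal g x (z x)) hinj).symm
    _ ≤ _ := Finset.sum_le_sum_of_subset_of_nonneg (Finset.subset_univ _)
        fun z _ _ => Finset.prod_nonneg fun x _ => coordMarginal_nonneg h0 _ _

/-- Subadditivity of entropy, as a bound on relative entropies with respect to uniform
distributions: the relative entropies of the marginals on `T` add up to at most that of `g`.
It is Gibbs' inequality for `g` and the product of its marginals. -/
theorem sum_relEntropy_coordMarginal_le (h0 : ∀ y, 0 ≤ g y) (h1 : ∑ y, g y = 1) {T : Finset ι}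
    (hT : ∀ y z, g y ≠ 0 → g z ≠ 0 → (∀ x ∈ T, y x = z x) → y = z) {q : ℝ} (hq : 0 < q) :
    ∑ x ∈ T, ∑ b, coordMarginal g x b * Real.log (coordMarginal g x b * q) ≤
      ∑ y, g y * Real.log (g y * q ^ T.card) := by
  simp_rw [sum_coordMarginal_mul g _ (fun b => Real.log (coordMarginal g _ b * q))]
  rw [Finset.sum_comm, ← sub_nonneg, ← Finset.sum_sub_distrib]
  have hle : ∀ y, (if g y ≠ 0 then g y - ∏ x ∈ T, coordMarginal g x (y x) else 0) ≤
      g y * Real.log (g y * q ^ T.card) -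
        ∑ x ∈ T, g y * Real.log (coordMarginal g x (y x) * q) := by
    intro y
    split_ifs with hy
    · have hm : ∀ x ∈ T, 0 < coordMarginal g x (y x) := fun x _ => coordMarginal_pos h0 x hy
      have hgy : 0 < g y := (h0 y).lt_of_ne' hy
      have hP : 0 < ∏ x ∈ T, coordMarginal g x (y x) := Finset.prod_pos hm
      have hlog := Real.log_le_sub_one_of_pos (div_pos hP hgy)
      rw [← Finset.mul_sum, ← Real.log_prod fun x hx => (mul_pos (hm x hx) hq).ne',
        Finset.prod_mul_distrib, Finset.prod_const, Real.log_mul hP.ne' (by positivity),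
        Real.log_mul hgy.ne' (by positivity)]
      rw [Real.log_div hP.ne' hgy.ne'] at hlog
      have := mul_le_mul_of_nonneg_left hlog hgy.le
      rw [mul_sub, mul_sub, mul_div_cancel₀ _ hgy.ne'] at this
      linarith
    · have : g y = 0 := not_not.1 hy
      simp [this]
  refine le_trans ?_ (Finset.sum_le_sum fun y _ => hle y)
  rw [← Finset.sum_filter, Finset.sum_sub_distrib, Finset.sum_filter_ne_zero, h1]
  linarith [sum_prod_coordMarginal_le_one h0 h1 hT]

/-- Some `D` of the values of `f` have an average at least that of all values. -/
theorem exists_card_eq_mul_sum_le (f : ι → ℝ) {D : ℕ} (hD : D ≤ Fintype.card ι) :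
    ∃ T : Finset ι, T.card = D ∧
      D * ∑ x, f x ≤ Fintype.card ι * ∑ x ∈ T, f x := by
  rcases Nat.eq_zero_or_pos (Fintype.card ι) with h | h
  · obtain rfl : D = 0 := by omega
    exact ⟨∅, rfl, by simp⟩
  have : NeZero (Fintype.card ι) := ⟨h.ne'⟩
  -- average over the translates of the window `{0, …, D - 1}` in a cyclic order of `ι`
  let e : ι ≃ ZMod (Fintype.card ι) := Fintype.equivOfCardEq (by simp)
  let w : ZMod (Fintype.card ι) → ℕ → ι := fun a j => e.symm (a + j)
  have hw : ∀ a, Set.InjOn (w a) (Finset.range D) := by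
    intro a i hi j hj hij
    have hi' : i < D := by simpa using hi
    have hj' : j < D := by simpa using hj
    have := add_left_cancel (e.symm.injective hij)
    rw [ZMod.natCast_eq_natCast_iff', Nat.mod_eq_of_lt (by omega), Nat.mod_eq_of_lt (by omega)]
      at this
    exact this
  by_contra! hcon
  have hsum : ∑ a, ∑ j ∈ Finset.range D, f (w a j) = D * ∑ x, f x := by
    rw [Finset.sum_comm, Finset.sum_congr rfl (g := fun _ => ∑ x, f x), Finset.sum_const,
      Finset.card_range, nsmul_eq_mul]
    intro j _
    exact Fintype.sum_equiv ((Equiv.addRight (j : ZMod (Fintype.card ι))).trans e.symm) _ _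
      fun _ => rfl
  have hlt : ∑ a : ZMod (Fintype.card ι), (Fintype.card ι : ℝ) * ∑ j ∈ Finset.range D, f (w a j) <
      ∑ _a : ZMod (Fintype.card ι), D * ∑ x, f x := by
    refine Finset.sum_lt_sum_of_nonempty Finset.univ_nonempty fun a _ => ?_
    rw [← Finset.sum_image (hw a)]
    exact hcon _ (by rw [Finset.card_image_of_injOn (hw a), Finset.card_range])
  rw [← Finset.mul_sum, hsum, Finset.sum_const, Finset.card_univ, ZMod.card, nsmul_eq_mul] at hlt
  exact lt_irrefl _ hlt

/-- If any `D` coordinates determine every point of the support of `g`, then the average relative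
entropy of the coordinates is at most `1 / D` times that of `g`. -/
theorem mul_sum_relEntropy_coordMarginal_le (h0 : ∀ y, 0 ≤ g y) (h1 : ∑ y, g y = 1) {D : ℕ}
    (hD : D ≤ Fintype.card ι)
    (hg : ∀ T : Finset ι, T.card = D →
      ∀ y z, g y ≠ 0 → g z ≠ 0 → (∀ x ∈ T, y x = z x) → y = z) {q : ℝ} (hq : 0 < q) :
    D * ∑ x, ∑ b, coordMarginal g x b * Real.log (coordMarginal g x b * q) ≤
      Fintype.card ι * ∑ y, g y * Real.log (g y * q ^ D) := by
  obtain ⟨T, rfl, hT⟩ := exists_card_eq_mul_sum_le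
    (fun x => ∑ b, coordMarginal g x b * Real.log (coordMarginal g x b * q)) hD
  exact hT.trans (mul_le_mul_of_nonneg_left
    (sum_relEntropy_coordMarginal_le h0 h1 (hg T rfl) hq) (Nat.cast_nonneg _))

end Entropy

/-! ### The Reed-Solomon code -/

open scoped Classical in
/-- The Reed-Solomon code: the words `(p(x))_{x ∈ X}` for polynomials `p` of degree at most `d`. -/
noncomputable def rsCode {q : ℕ} [NeZero q] (d : ℕ) (X : Finset (ZMod q)) :
    Finset ({x // x ∈ X} → ZMod q) :=
  Finset.univ.filter fun c => ∃ p : Polynomial (ZMod q), p.degree ≤ d ∧ ∀ x, p.eval x.1 = c x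

section Code

variable {q d : ℕ} [Fact q.Prime] {X : Finset (ZMod q)}

theorem mem_rsCode {c : {x // x ∈ X} → ZMod q} :
    c ∈ rsCode d X ↔ ∃ p : Polynomial (ZMod q), p.degree ≤ d ∧ ∀ x, p.eval x.1 = c x := by
  simp [rsCode]

theorem rsCode_add_mem {c c' : {x // x ∈ X} → ZMod q} (h : c ∈ rsCode d X)
    (h' : c' ∈ rsCode d X) : c + c' ∈ rsCode d X := by
  obtain ⟨p, hp, hc⟩ := mem_rsCode.1 h
  obtain ⟨p', hp', hc'⟩ := mem_rsCode.1 h'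
  exact mem_rsCode.2 ⟨p + p', (Polynomial.degree_add_le _ _).trans (max_le hp hp'),
    fun x => by simp [hc, hc']⟩

theorem rsCode_sub_mem {c c' : {x // x ∈ X} → ZMod q} (h : c ∈ rsCode d X)
    (h' : c' ∈ rsCode d X) : c - c' ∈ rsCode d X := by
  obtain ⟨p, hp, hc⟩ := mem_rsCode.1 h
  obtain ⟨p', hp', hc'⟩ := mem_rsCode.1 h'
  exact mem_rsCode.2 ⟨p - p', (Polynomial.degree_sub_le _ _).trans (max_le hp hp'),
    fun x => by simp [hc, hc']⟩

theorem exists_mem_rsCode_eqOn {T : Finset {x // x ∈ X}} (hT : T.card ≤ d + 1)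
    (v : {x // x ∈ X} → ZMod q) : ∃ c ∈ rsCode d X, ∀ x ∈ T, c x = v x := by
  have hinj : Set.InjOn (Subtype.val : {x // x ∈ X} → ZMod q) T := Subtype.val_injective.injOn
  refine ⟨fun x => (Lagrange.interpolate T Subtype.val v).eval x.1,
    mem_rsCode.2 ⟨_, ?_, fun _ => rfl⟩,
    fun x hx => Lagrange.eval_interpolate_at_node v hinj hx⟩
  have h := (Lagrange.degree_interpolate_lt v hinj).trans_le (Nat.cast_le.2 hT)
  exact (Polynomial.degree_le_iff_coeff_zero _ _).2 fun m hm =>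
    (Polynomial.degree_lt_iff_coeff_zero _ _).1 h m (Nat.cast_lt.1 hm)

theorem rsCode_eq_of_eqOn {T : Finset {x // x ∈ X}} (hT : d + 1 ≤ T.card)
    {c c' : {x // x ∈ X} → ZMod q} (h : c ∈ rsCode d X) (h' : c' ∈ rsCode d X)
    (hc : ∀ x ∈ T, c x = c' x) : c = c' := by
  obtain ⟨p, hp, hpc⟩ := mem_rsCode.1 h
  obtain ⟨p', hp', hpc'⟩ := mem_rsCode.1 h'
  have hlt : (d : WithBot ℕ) < T.card := Nat.cast_lt.2 hT
  have : p = p' := Polynomial.eq_of_degrees_lt_of_eval_index_eq T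
    Subtype.val_injective.injOn (hp.trans_lt hlt) (hp'.trans_lt hlt)
    fun x hx => by rw [hpc, hpc', hc x hx]
  funext x
  rw [← hpc, ← hpc', this]

/-- On at most `d + 1` coordinates, the code takes all values equally often. -/
theorem card_rsCode_eqOn {T : Finset {x // x ∈ X}} (hT : T.card ≤ d + 1)
    (v : {x // x ∈ X} → ZMod q) :
    ((rsCode d X).filter fun c => ∀ x ∈ T, c x = v x).card * q ^ T.card = (rsCode d X).card := by
  have hconst : ∀ u : T → ZMod q,
      ((rsCode d X).filter fun c => (fun x : T => c x) = u).card =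
        ((rsCode d X).filter fun c => ∀ x ∈ T, c x = v x).card := by
    intro u
    obtain ⟨c₀, hc₀, h₀⟩ := exists_mem_rsCode_eqOn (d := d) hT
      (v - fun x => if h : x ∈ T then u ⟨x, h⟩ else 0)
    refine Finset.card_bij' (fun c _ => c + c₀) (fun c _ => c - c₀) ?_ ?_ ?_ ?_
    · intro c hc
      obtain ⟨hc', rfl⟩ := Finset.mem_filter.1 hc
      refine Finset.mem_filter.2 ⟨rsCode_add_mem hc' hc₀, fun x hx => ?_⟩
      simp [h₀ x hx, hx]
    · intro c hc
      obtain ⟨hc, h⟩ := Finset.mem_filter.1 hc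
      refine Finset.mem_filter.2 ⟨rsCode_sub_mem hc hc₀, funext fun x => ?_⟩
      simp [h₀ x x.2, h x x.2]
    · intro c _
      simp
    · intro c _
      simp
  rw [Finset.card_eq_sum_card_fiberwise (s := rsCode d X) (t := Finset.univ)
    (f := fun c (x : T) => c x) (fun _ _ => Finset.mem_coe.2 (Finset.mem_univ _)),
    Finset.sum_congr rfl fun u _ => hconst u, Finset.sum_const, Finset.card_univ]
  simp [mul_comm]

theorem card_rsCode (hd : d + 1 ≤ X.card) : (rsCode d X).card = q ^ (d + 1) := by
  obtain ⟨T, -, hT⟩ := Finset.exists_subset_card_eq (s := (Finset.univ : Finset {x // x ∈ X}))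
    (n := d + 1) (by simpa using hd)
  obtain ⟨c, hc, -⟩ := exists_mem_rsCode_eqOn (d := d) hT.le 0
  rw [← card_rsCode_eqOn hT.le c, hT]
  suffices h : ((rsCode d X).filter fun c' => ∀ x ∈ T, c' x = c x).card = 1 by rw [h, one_mul]
  rw [Finset.card_eq_one]
  refine ⟨c, Finset.eq_singleton_iff_unique_mem.2 ⟨by simp [hc], fun c' hc' => ?_⟩⟩
  obtain ⟨h, h'⟩ := Finset.mem_filter.1 hc'
  exact rsCode_eq_of_eqOn hT.ge h hc h'

/-- For a fixed word `y`, the word `(π_x(y_x))_x` is uniformly distributed when `π` is; hence it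
lies in the code with probability `|rsCode| / q ^ |X|`. -/
theorem card_perm_mem_rsCode (y : {x // x ∈ X} → ZMod q) :
    (Finset.univ.filter fun π : {x // x ∈ X} → Equiv.Perm (ZMod q) =>
        (fun x => π x (y x)) ∈ rsCode d X).card * q ^ X.card =
      (rsCode d X).card * Fintype.card ({x // x ∈ X} → Equiv.Perm (ZMod q)) := by
  have hconst : ∀ a : {x // x ∈ X} → ZMod q,
      (Finset.univ.filter fun π : {x // x ∈ X} → Equiv.Perm (ZMod q) =>
        (fun x => π x (y x)) + a ∈ rsCode d X).card =
      (Finset.univ.filter fun π : {x // x ∈ X} → Equiv.Perm (ZMod q) =>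
        (fun x => π x (y x)) ∈ rsCode d X).card := by
    intro a
    refine Finset.card_bij' (fun π _ x => (π x).trans (Equiv.addRight (a x)))
      (fun π _ x => (π x).trans (Equiv.addRight (-a x))) ?_ ?_ ?_ ?_
    · intro π hπ
      simpa [Pi.add_def] using hπ
    · intro π hπ
      simpa [Pi.add_def] using hπ
    · intro π _
      ext; simp
    · intro π _
      ext; simp
  have hsum := Finset.sum_card_bipartiteAbove_eq_sum_card_bipartiteBelow
    (s := (Finset.univ : Finset ({x // x ∈ X} → ZMod q)))
    (t := (Finset.univ : Finset ({x // x ∈ X} → Equiv.Perm (ZMod q))))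
    (fun a π => (fun x => π x (y x)) + a ∈ rsCode d X)
  simp only [Finset.bipartiteAbove, Finset.bipartiteBelow] at hsum
  have htrans : ∀ z : {x // x ∈ X} → ZMod q,
      (Finset.univ.filter fun a => z + a ∈ rsCode d X).card = (rsCode d X).card := by
    intro z
    refine Finset.card_bij' (fun a _ => z + a) (fun c _ => c - z) ?_ ?_ ?_ ?_ <;>
      simp
  rw [Finset.sum_congr rfl fun a _ => hconst a, Finset.sum_congr rfl fun π _ => htrans _] at hsum
  simpa [mul_comm] using hsum

end Code

/-! ### The down operator -/

section DownLaw

variable {Ω : Type*} [Fintype Ω] [DecidableEq Ω] {k l : ℕ}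

theorem KSet.card_subsets (S : KSet Ω k) :
    (Finset.univ.filter fun T : KSet Ω l => T.1 ⊆ S.1).card = k.choose l := by
  rw [← congrArg (fun n => n.choose l) S.2, ← Finset.card_powersetCard]
  refine Finset.card_bij (fun T _ => T.1) (fun T hT => ?_) (fun T _ T' _ h => Subtype.ext h)
    fun T hT => ?_
  · exact Finset.mem_powersetCard.2 ⟨(Finset.mem_filter.1 hT).2, T.2⟩
  · obtain ⟨hT, hc⟩ := Finset.mem_powersetCard.1 hT
    exact ⟨⟨T, hc⟩, by simpa using hT, rfl⟩

theorem downLaw_apply (h : l ≤ k) (μ : PMF (KSet Ω k)) (U : KSet Ω l) :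
    downLaw h μ U = μ.toOuterMeasure {S | U.1 ⊆ S.1} * (k.choose l : ℝ≥0∞)⁻¹ := by
  classical
  rw [downLaw, PMF.bind_apply, tsum_fintype, PMF.toOuterMeasure_apply_fintype, Finset.sum_mul]
  refine Finset.sum_congr rfl fun S _ => ?_
  rw [downRow, PMF.uniformOfFinset_apply, KSet.card_subsets]
  by_cases hU : U.1 ⊆ S.1 <;> simp [hU]

end DownLaw

/-! ### Marginals and entropic independence of the permuted Reed-Solomon distribution -/

section RSLaw

variable {q k d : ℕ} {X : Finset (ZMod q)}

theorem rsGraph_injective (hX : X.card = k) : Function.Injective (rsGraph (q := q) hX) := by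
  intro y y' h
  funext x
  have hx : (x, y x) ∈ (rsGraph hX y').1 := by
    rw [← h]
    exact Finset.mem_map.2 ⟨x, Finset.mem_univ _, rfl⟩
  obtain ⟨x', -, hx'⟩ := Finset.mem_map.1 hx
  obtain ⟨rfl, h⟩ := Prod.ext_iff.1 hx'
  exact h.symm

theorem subset_rsGraph_iff (hX : X.card = k) {T : Finset (RSGround X)}
    {y : {x // x ∈ X} → ZMod q} :
    T ⊆ (rsGraph hX y).1 ↔ ∀ p ∈ T, y p.1 = p.2 := by
  refine forall₂_congr fun p _ => ?_
  rw [rsGraph, Finset.mem_map]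
  constructor
  · rintro ⟨x, -, rfl⟩
    rfl
  · exact fun h => ⟨p.1, Finset.mem_univ _, Prod.ext rfl h⟩

variable [Fact q.Prime]

theorem rsGraph_mem_rsSupport (hX : X.card = k) {π : {x // x ∈ X} → Equiv.Perm (ZMod q)}
    {y : {x // x ∈ X} → ZMod q} :
    rsGraph hX y ∈ rsSupport d hX π ↔ (fun x => π x (y x)) ∈ rsCode d X := by
  classical
  rw [mem_rsCode, rsSupport, Finset.mem_filter]
  constructor
  · rintro ⟨-, y', p, h, hp, hpy⟩
    rw [rsGraph_injective hX h]
    exact ⟨p, hp, hpy⟩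
  · rintro ⟨p, hp, hpy⟩
    exact ⟨Finset.mem_univ _, y, p, rfl, hp, hpy⟩

theorem exists_rsGraph_of_mem_rsSupport (hX : X.card = k)
    {π : {x // x ∈ X} → Equiv.Perm (ZMod q)} {S : KSet (RSGround X) k}
    (hS : S ∈ rsSupport d hX π) : ∃ y, rsGraph hX y = S := by
  classical
  obtain ⟨-, y, -, h, -⟩ := Finset.mem_filter.1 hS
  exact ⟨y, h.symm⟩

theorem card_rsSupport_filter_subset (hX : X.card = k)
    (π : {x // x ∈ X} → Equiv.Perm (ZMod q)) (T : Finset (RSGround X)) :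
    ((rsSupport d hX π).filter fun S => T ⊆ S.1).card =
      ((rsCode d X).filter fun c => ∀ p ∈ T, c p.1 = π p.1 p.2).card := by
  symm
  refine Finset.card_bij (fun c _ => rsGraph hX fun x => (π x).symm (c x)) ?_ ?_ ?_
  · intro c hc
    obtain ⟨hc, hT⟩ := Finset.mem_filter.1 hc
    refine Finset.mem_filter.2 ⟨rsGraph_mem_rsSupport hX |>.2 (by simpa using hc),
      (subset_rsGraph_iff hX).2 fun p hp => ?_⟩
    rw [hT p hp, Equiv.symm_apply_apply]
  · intro c _ c' _ h
    funext x
    exact (π x).symm.injective (congrFun (rsGraph_injective hX h) x)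
  · intro S hS
    obtain ⟨hS, hT⟩ := Finset.mem_filter.1 hS
    obtain ⟨y, rfl⟩ := exists_rsGraph_of_mem_rsSupport hX hS
    refine ⟨fun x => π x (y x), Finset.mem_filter.2 ⟨(rsGraph_mem_rsSupport hX).1 hS,
      fun p hp => ?_⟩, by simp⟩
    simp only [(subset_rsGraph_iff hX).1 hT p hp]

theorem card_rsSupport (hX : X.card = k) (π : {x // x ∈ X} → Equiv.Perm (ZMod q)) :
    (rsSupport d hX π).card = (rsCode d X).card := by
  simpa using card_rsSupport_filter_subset (d := d) hX π ∅

theorem rsLaw_toOuterMeasure_subset (hX : X.card = k)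
    (π : {x // x ∈ X} → Equiv.Perm (ZMod q)) (T : Finset (RSGround X)) :
    (rsLaw d hX π).toOuterMeasure {S | T ⊆ S.1} =
      (((rsCode d X).filter fun c => ∀ p ∈ T, c p.1 = π p.1 p.2).card : ℝ≥0∞) /
        (rsCode d X).card := by
  classical
  rw [rsLaw, PMF.toOuterMeasure_uniformOfFinset_apply, card_rsSupport,
    ← card_rsSupport_filter_subset hX]
  congr!

/-- The marginals of order at most `d + 1` carry no information on the permutations: whether the
prescribed values are consistent does not depend on `π`, and consistent values on at most `d + 1`
points are taken by equally many code words. -/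
theorem marginals_rsLaw_eq (hX : X.card = k) (π π' : {x // x ∈ X} → Equiv.Perm (ZMod q)) :
    marginals (d + 1) (rsLaw d hX π) = marginals (d + 1) (rsLaw d hX π') := by
  funext ⟨T, hT⟩
  simp only [marginals, rsLaw_toOuterMeasure_subset]
  congr 2
  by_cases hy : ∃ y : {x // x ∈ X} → ZMod q, ∀ p ∈ T, y p.1 = p.2
  · obtain ⟨y, hy⟩ := hy
    have hcond : ∀ (σ : {x // x ∈ X} → Equiv.Perm (ZMod q)) (c : {x // x ∈ X} → ZMod q),
        (∀ p ∈ T, c p.1 = σ p.1 p.2) ↔ ∀ x ∈ T.image Prod.fst, c x = σ x (y x) := by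
      intro σ c
      rw [Finset.forall_mem_image]
      exact forall₂_congr fun p hp => by rw [hy p hp]
    simp_rw [hcond]
    have hq : 0 < q ^ (T.image Prod.fst).card := pow_pos (Fact.out : q.Prime).pos _
    have hc : (T.image Prod.fst).card ≤ d + 1 := Finset.card_image_le.trans hT
    exact Nat.eq_of_mul_eq_mul_right hq
      ((card_rsCode_eqOn hc _).trans (card_rsCode_eqOn hc _).symm)
  · have hempty : ∀ σ : {x // x ∈ X} → Equiv.Perm (ZMod q),
        ((rsCode d X).filter fun c => ∀ p ∈ T, c p.1 = σ p.1 p.2) = ∅ := by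
      refine fun σ => Finset.filter_eq_empty_iff.2 fun c _ hc => hy ⟨fun x => (σ x).symm (c x), ?_⟩
      intro p hp
      simp only [hc p hp, Equiv.symm_apply_apply]
    rw [hempty, hempty]

theorem downLaw_one_rsLaw_apply (hX : X.card = k) (hk : 1 ≤ k)
    (π : {x // x ∈ X} → Equiv.Perm (ZMod q)) (p : RSGround X) :
    downLaw hk (rsLaw d hX π) ⟨{p}, Finset.card_singleton p⟩ =
      (q : ℝ≥0∞)⁻¹ * (k : ℝ≥0∞)⁻¹ := by
  rw [downLaw_apply, rsLaw_toOuterMeasure_subset, Nat.choose_one_right]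
  congr 1
  have h := card_rsCode_eqOn (d := d) (T := {p.1}) (by simp) fun x => π x p.2
  have hpos : (rsCode d X).card ≠ 0 := by
    rw [← card_rsSupport hX π]
    exact (Finset.card_pos.2 (rsSupport_nonempty d hX π)).ne'
  simp only [Finset.mem_singleton, forall_eq, Finset.card_singleton, pow_one] at h ⊢
  set N := ((rsCode d X).filter fun c => c p.1 = π p.1 p.2).card
  have hN : N ≠ 0 := fun h0 => hpos (by rw [← h, h0, zero_mul])
  rw [← h, Nat.cast_mul, ENNReal.div_eq_inv_mul, ENNReal.mul_inv (by simp [hN]) (by simp),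
    mul_comm, ← mul_assoc, ENNReal.mul_inv_cancel (by simp [hN]) (by simp), one_mul]

theorem rsLaw_apply_eq_zero_iff (hX : X.card = k) {π : {x // x ∈ X} → Equiv.Perm (ZMod q)}
    {S : KSet (RSGround X) k} : rsLaw d hX π S = 0 ↔ S ∉ rsSupport d hX π := by
  rw [PMF.apply_eq_zero_iff, rsLaw, PMF.support_uniformOfFinset, Finset.mem_coe]

theorem rsLaw_apply_of_mem (hd : d + 1 ≤ k) (hX : X.card = k)
    {π : {x // x ∈ X} → Equiv.Perm (ZMod q)} {S : KSet (RSGround X) k}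
    (hS : S ∈ rsSupport d hX π) : rsLaw d hX π S = ((q : ℝ≥0∞) ^ (d + 1))⁻¹ := by
  rw [rsLaw, PMF.uniformOfFinset_apply_of_mem _ hS, card_rsSupport,
    card_rsCode (hd.trans_eq hX.symm), Nat.cast_pow]

theorem sum_eq_sum_rsGraph (hX : X.card = k) (f : KSet (RSGround X) k → ℝ)
    (hf : ∀ S, (∀ y, rsGraph hX y ≠ S) → f S = 0) : ∑ S, f S = ∑ y, f (rsGraph hX y) :=
  (Fintype.sum_of_injective _ (rsGraph_injective hX) _ _
    (fun S hS => hf S fun y hy => hS ⟨y, hy⟩) fun _ => rfl).symm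

theorem toReal_downLaw_one_apply (hX : X.card = k) (hk : 1 ≤ k) {ν : PMF (KSet (RSGround X) k)}
    (hν : ∀ S, (∀ y, rsGraph hX y ≠ S) → ν S = 0) (p : RSGround X) :
    (downLaw hk ν ⟨{p}, Finset.card_singleton p⟩).toReal =
      coordMarginal (fun y => (ν (rsGraph hX y)).toReal) p.1 p.2 / k := by
  classical
  rw [downLaw_apply, PMF.toOuterMeasure_apply_fintype, Nat.choose_one_right, ENNReal.toReal_mul,
    ENNReal.toReal_inv, ENNReal.toReal_natCast, div_eq_mul_inv, ENNReal.toReal_sum,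
    sum_eq_sum_rsGraph hX, coordMarginal, Finset.sum_filter]
  · congr 1
    refine Finset.sum_congr rfl fun y _ => ?_
    have := subset_rsGraph_iff hX (T := {p}) (y := y)
    simp only [Finset.mem_singleton, forall_eq] at this
    by_cases h : y p.1 = p.2
    · rw [Set.indicator_of_mem (this.2 h), if_pos h]
    · rw [Set.indicator_of_notMem (fun h' => h (this.1 h')), if_neg h, ENNReal.toReal_zero]
  · intro S hS
    simp [Set.indicator_apply, hν S hS]
  · intro S _
    exact ((Set.indicator_le_self _ _ _).trans_lt (ν.apply_lt_top S)).ne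

theorem KSet.sum_one {Ω : Type*} [Fintype Ω] [DecidableEq Ω] (f : KSet Ω 1 → ℝ) :
    ∑ U, f U = ∑ p : Ω, f ⟨{p}, Finset.card_singleton p⟩ := by
  refine (Fintype.sum_bijective (fun p : Ω => (⟨{p}, Finset.card_singleton p⟩ : KSet Ω 1))
    ⟨fun p p' h => ?_, fun U => ?_⟩ _ _ fun _ => rfl).symm
  · exact Finset.singleton_injective (congrArg Subtype.val h)
  · obtain ⟨p, hp⟩ := Finset.card_eq_one.1 U.2
    exact ⟨p, Subtype.ext hp.symm⟩

/-- In terms of words, the inequality is `mul_sum_relEntropy_coordMarginal_le` divided by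
`k * (d + 1)`. -/
theorem entropicallyIndependent_rsLaw (hd : d + 1 ≤ k) (hk : 1 ≤ k) (hX : X.card = k)
    (π : {x // x ∈ X} → Equiv.Perm (ZMod q)) :
    EntropicallyIndependent hk (((d : ℝ) + 1) / k) (rsLaw d hX π) := by
  have hk0 : (0 : ℝ) < k := by exact_mod_cast hk
  have hq0 : (0 : ℝ) < q := by exact_mod_cast (Fact.out : q.Prime).pos
  have hαk : ((d : ℝ) + 1) / k * k = d + 1 := div_mul_cancel₀ _ hk0.ne'
  refine ⟨by positivity, (div_le_one hk0).2 (by exact_mod_cast hd), fun ν => ?_⟩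
  rw [hαk]
  by_cases hac : ∀ S, rsLaw d hX π S = 0 → ν S = 0
  swap
  -- the divergence on the right is infinite
  · rw [InformationTheory.klDiv_of_not_ac
      (fun h => hac (PMF.toMeasure_absolutelyContinuous_iff.1 h)), ENNReal.mul_top]
    · exact le_top
    · exact (ENNReal.ofReal_pos.2 (by positivity)).ne'
  have hsupp : ∀ S, ν S ≠ 0 → S ∈ rsSupport d hX π := fun S hS => by
    by_contra h
    exact hS (hac S ((rsLaw_apply_eq_zero_iff hX).2 h))
  have hν : ∀ S, (∀ y, rsGraph hX y ≠ S) → ν S = 0 := fun S hS => by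
    by_contra h
    obtain ⟨y, hy⟩ := exists_rsGraph_of_mem_rsSupport hX (hsupp S h)
    exact hS y hy
  have hdown : ∀ U, downLaw hk (rsLaw d hX π) U = 0 → downLaw hk ν U = 0 := by
    intro U hU
    obtain ⟨p, hp⟩ := Finset.card_eq_one.1 U.2
    obtain rfl : U = ⟨{p}, Finset.card_singleton p⟩ := Subtype.ext hp
    rw [downLaw_one_rsLaw_apply] at hU
    simp at hU
  set g : ({x // x ∈ X} → ZMod q) → ℝ := fun y => (ν (rsGraph hX y)).toReal with hg
  have hg0 : ∀ y, 0 ≤ g y := fun y => ENNReal.toReal_nonneg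
  have hg1 : ∑ y, g y = 1 := by
    rw [← sum_eq_sum_rsGraph hX (fun S => (ν S).toReal) fun S hS => by rw [hν S hS]; rfl,
      ← ENNReal.toReal_sum fun S _ => ν.apply_ne_top S, ← tsum_fintype (L := .unconditional _),
      ν.tsum_coe, ENNReal.toReal_one]
  have hgmem : ∀ y, g y ≠ 0 → (fun x => π x (y x)) ∈ rsCode d X := fun y hy =>
    (rsGraph_mem_rsSupport hX).1 (hsupp _ fun h => hy (by simp [hg, h]))
  have key := mul_sum_relEntropy_coordMarginal_le hg0 hg1 (D := d + 1)
    (by simpa [hX] using hd) (fun T hT y z hy hz hyz => by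
      have := rsCode_eq_of_eqOn hT.ge (hgmem y hy) (hgmem z hz) fun x hx => by rw [hyz x hx]
      exact funext fun x => (π x).injective (congrFun this x)) hq0
  rw [PMF.klDiv_toMeasure hac, PMF.klDiv_toMeasure hdown,
    ← ENNReal.ofReal_mul (by positivity)]
  refine ENNReal.ofReal_le_ofReal ?_
  have hR : ∑ S, (ν S).toReal * Real.log ((ν S).toReal / (rsLaw d hX π S).toReal) =
      ∑ y, g y * Real.log (g y * (q : ℝ) ^ (d + 1)) := by
    rw [sum_eq_sum_rsGraph hX _ fun S hS => by rw [hν S hS]; simp]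
    refine Finset.sum_congr rfl fun y _ => ?_
    by_cases hy : ν (rsGraph hX y) = 0
    · simp [hg, hy]
    · rw [rsLaw_apply_of_mem hd hX (hsupp _ hy)]
      simp [hg]
  have hL : ∑ U, (downLaw hk ν U).toReal *
        Real.log ((downLaw hk ν U).toReal / (downLaw hk (rsLaw d hX π) U).toReal) =
      (∑ x, ∑ b, coordMarginal g x b * Real.log (coordMarginal g x b * q)) / k := by
    rw [KSet.sum_one, Fintype.sum_prod_type, Finset.sum_div]
    refine Finset.sum_congr rfl fun x _ => ?_
    rw [Finset.sum_div]
    refine Finset.sum_congr rfl fun b _ => ?_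
    rw [toReal_downLaw_one_apply hX hk hν, downLaw_one_rsLaw_apply]
    simp only [ENNReal.toReal_mul, ENNReal.toReal_inv, ENNReal.toReal_natCast]
    rw [show coordMarginal g x b / k / ((q : ℝ)⁻¹ * (k : ℝ)⁻¹) = coordMarginal g x b * q by
      field_simp]
    ring
  rw [hL, hR, one_div, ← div_eq_inv_mul, div_le_div_iff₀ hk0 (by positivity)]
  rw [Fintype.card_coe, hX] at key
  push_cast at key
  linarith

end RSLaw

/-! ### Sampling from external fields, and sparsification schemes -/

section Schemes

variable {Ω : Type*} {k m : ℕ}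

theorem measurable_fieldWeight (μ : PMF (KSet Ω k)) (S : KSet Ω k) :
    Measurable fun w : Ω → ℝ≥0 => fieldWeight μ w S := by
  unfold fieldWeight
  fun_prop

variable [Fintype Ω]

theorem fieldSample_apply_none (μ : PMF (KSet Ω k)) (w : Ω → ℝ≥0) :
    fieldSample μ w none =
      {w : Ω → ℝ≥0 | ∑' S, fieldWeight μ w S = 0}.indicator (fun _ => 1) w := by
  unfold fieldSample
  by_cases h : ∑' S, fieldWeight μ w S = 0
  · rw [dif_pos h, Set.indicator_of_mem (by exact h), PMF.pure_apply, if_pos rfl]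
  · rw [dif_neg h, Set.indicator_of_notMem (by exact h), PMF.map_apply]
    simp

theorem fieldSample_apply_some (μ : PMF (KSet Ω k)) (w : Ω → ℝ≥0) (S : KSet Ω k) :
    fieldSample μ w (some S) = fieldWeight μ w S * (∑' S, fieldWeight μ w S)⁻¹ := by
  unfold fieldSample
  by_cases h : ∑' S, fieldWeight μ w S = 0
  · rw [dif_pos h, ENNReal.tsum_eq_zero.1 h S, PMF.pure_apply]
    simp
  · classical
    rw [dif_neg h, PMF.map_apply, tsum_eq_single S, if_pos rfl, PMF.normalize_apply]
    intro S' hS'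
    rw [if_neg fun h => hS' (Option.some_injective _ h).symm]

theorem measurable_tsum_fieldWeight (μ : PMF (KSet Ω k)) :
    Measurable fun w : Ω → ℝ≥0 => ∑' S, fieldWeight μ w S := by
  simp only [tsum_fintype]
  exact Finset.measurable_sum _ fun S _ => measurable_fieldWeight μ S

theorem measurableSet_tsum_fieldWeight_eq_zero (μ : PMF (KSet Ω k)) :
    MeasurableSet {w : Ω → ℝ≥0 | ∑' S, fieldWeight μ w S = 0} :=
  measurable_tsum_fieldWeight μ (measurableSet_singleton 0)

theorem measurable_fieldSample (μ : PMF (KSet Ω k)) (o : Option (KSet Ω k)) :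
    Measurable fun w : Ω → ℝ≥0 => fieldSample μ w o := by
  cases o with
  | none =>
    simp only [fieldSample_apply_none]
    exact measurable_const.indicator (measurableSet_tsum_fieldWeight_eq_zero μ)
  | some S =>
    simp only [fieldSample_apply_some]
    exact (measurable_fieldWeight μ S).mul (measurable_tsum_fieldWeight μ).inv

variable [DecidableEq Ω] (A : SparsificationScheme Ω m) (hm : m ≤ k)

namespace SparsificationScheme

/-- The oracles answer according to `μ D_{k → l}`, `l ≤ m`, which is determined by the marginals of
order `l`; hence a scheme cannot tell apart distributions with the same marginals. -/
theorem fieldLaw_congr {μ μ' : PMF (KSet Ω k)} (h : marginals m μ = marginals m μ') :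
    A.fieldLaw hm μ = A.fieldLaw hm μ' := by
  have hdown : ∀ (l : ℕ) (hl : l ≤ m), downLaw (hl.trans hm) μ = downLaw (hl.trans hm) μ' := by
    intro l hl
    refine PMF.ext fun U => ?_
    rw [downLaw_apply, downLaw_apply]
    exact congrArg (· * (k.choose l : ℝ≥0∞)⁻¹) (congrFun h ⟨U.1, U.2.trans_le hl⟩)
  have hlaw : marginalSamplesLaw hm μ = marginalSamplesLaw hm μ' := by
    unfold marginalSamplesLaw
    congr 1
    funext i
    rw [hdown i.2 (Nat.lt_succ_iff.1 i.2.2)]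
  rw [fieldLaw, fieldLaw, h, hlaw]

instance (μ : PMF (KSet Ω k)) : IsProbabilityMeasure (A.fieldLaw hm μ) := by
  have := A.isMarkov (marginals m μ)
  unfold fieldLaw marginalSamplesLaw
  infer_instance

theorem outputProb_none (μ : PMF (KSet Ω k)) :
    A.outputProb hm μ none = A.fieldLaw hm μ {w | ∑' S, fieldWeight μ w S = 0} := by
  rw [outputProb]
  simp only [fieldSample_apply_none]
  rw [lintegral_indicator (measurableSet_tsum_fieldWeight_eq_zero μ), setLIntegral_const, one_mul]

theorem sum_outputProb (μ : PMF (KSet Ω k)) : ∑ o, A.outputProb hm μ o = 1 := by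
  simp only [outputProb]
  rw [← lintegral_finsetSum _ fun o _ => measurable_fieldSample μ o]
  simp only [← tsum_fintype (L := .unconditional _), PMF.tsum_coe]
  simp

/-- The total variation error is at least the probability that sampling fails. -/
theorem toReal_outputProb_none_le_tvError (μ : PMF (KSet Ω k)) :
    (A.outputProb hm μ none).toReal ≤ A.tvError hm μ := by
  have hne : ∀ o, A.outputProb hm μ o ≠ ∞ := fun o => by
    refine ((Finset.single_le_sum (fun _ _ => zero_le) (Finset.mem_univ o)).trans_lt
      (b := ∑ o, A.outputProb hm μ o) ?_).ne
    rw [sum_outputProb]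
    exact ENNReal.one_lt_top
  have h1 : ∑ o, (A.outputProb hm μ o).toReal = 1 := by
    rw [← ENNReal.toReal_sum fun o _ => hne o, sum_outputProb, ENNReal.toReal_one]
  have h2 : ∑ o, ((μ.map some) o).toReal = 1 := by
    rw [← ENNReal.toReal_sum fun o _ => (μ.map some).apply_ne_top o,
      ← tsum_fintype (L := .unconditional _), PMF.tsum_coe, ENNReal.toReal_one]
  have h3 : (μ.map some) none = 0 := by
    rw [PMF.map_apply]
    simp
  have h4 := Finset.abs_sum_le_sum_abs (s := Finset.univ) fun S : KSet Ω k =>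
    (A.outputProb hm μ (some S)).toReal - ((μ.map some) (some S)).toReal
  rw [Fintype.sum_option] at h1 h2
  rw [tvError, Fintype.sum_option, h3]
  rw [h3, ENNReal.toReal_zero, zero_add] at h2
  rw [Finset.sum_sub_distrib, h2, eq_sub_of_add_eq' h1] at h4
  have h5 : (0 : ℝ) ≤ (A.outputProb hm μ none).toReal := ENNReal.toReal_nonneg
  rw [ENNReal.toReal_zero, sub_zero, abs_of_nonneg h5]
  have h6 := (neg_le_abs _).trans h4
  linarith

/-- An accurate scheme outputs, with probability at least `1 - ε`, a field that can be sampled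
from. -/
theorem ofReal_one_sub_le_fieldLaw {μ : PMF (KSet Ω k)} {ε : ℝ} (h : A.tvError hm μ ≤ ε) :
    ENNReal.ofReal (1 - ε) ≤ A.fieldLaw hm μ {w | ∑' S, fieldWeight μ w S ≠ 0} := by
  have hc : {w : Ω → ℝ≥0 | ∑' S, fieldWeight μ w S ≠ 0} =
      {w | ∑' S, fieldWeight μ w S = 0}ᶜ := rfl
  rw [hc, ← ENNReal.ofReal_toReal (measure_ne_top (A.fieldLaw hm μ) _)]
  refine ENNReal.ofReal_le_ofReal ?_
  have := A.toReal_outputProb_none_le_tvError hm μ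
  rw [outputProb_none] at this
  rw [← measureReal_def, probReal_compl_eq_one_sub (measurableSet_tsum_fieldWeight_eq_zero μ),
    measureReal_def]
  linarith

end SparsificationScheme

end Schemes

/-! ### The lower bound -/

section LowerBound

variable {q k d : ℕ} [Fact q.Prime] {X : Finset (ZMod q)}

open scoped Classical in
/-- A fixed field with at most `t` nonzero entries supports at most `t ^ k` words, each of which
is in the support of `rsLaw` for a fraction `q ^ (d + 1) / q ^ k` of all permutations. -/
theorem card_perm_tsum_fieldWeight_ne_zero_le (hd : d + 1 ≤ k) (hX : X.card = k) {t : ℕ}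
    {w : RSGround X → ℝ≥0} (hw : (Finset.univ.filter fun i => w i ≠ 0).card ≤ t) :
    (Finset.univ.filter fun π : {x // x ∈ X} → Equiv.Perm (ZMod q) =>
        ∑' S, fieldWeight (rsLaw d hX π) w S ≠ 0).card * q ^ k ≤
      t ^ k * (q ^ (d + 1) * Fintype.card ({x // x ∈ X} → Equiv.Perm (ZMod q))) := by
  set Y : Finset ({x // x ∈ X} → ZMod q) := Finset.univ.filter fun y => ∀ x, w (x, y x) ≠ 0
  have hY : Y.card ≤ t ^ k := by
    have h := Finset.card_le_card_of_injOn (s := Y)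
      (t := Fintype.piFinset fun _ : {x // x ∈ X} => Finset.univ.filter fun i => w i ≠ 0)
      (fun y x => (x, y x))
      (fun y hy => by simpa [Y] using hy)
      fun y _ y' _ h => funext fun x => congrArg Prod.snd (congrFun h x)
    rw [Fintype.card_piFinset, Finset.prod_const, Finset.card_univ, Fintype.card_coe, hX] at h
    exact h.trans (Nat.pow_le_pow_left hw k)
  have hsub : (Finset.univ.filter fun π : {x // x ∈ X} → Equiv.Perm (ZMod q) =>
      ∑' S, fieldWeight (rsLaw d hX π) w S ≠ 0) ⊆
      Y.biUnion fun y => Finset.univ.filter fun π => (fun x => π x (y x)) ∈ rsCode d X := by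
    intro π hπ
    obtain ⟨S, hS⟩ : ∃ S, fieldWeight (rsLaw d hX π) w S ≠ 0 := by
      by_contra! h
      exact (Finset.mem_filter.1 hπ).2 (ENNReal.tsum_eq_zero.2 h)
    obtain ⟨hμ, hprod⟩ := mul_ne_zero_iff.1 hS
    have hmem : S ∈ rsSupport d hX π := by
      by_contra h
      exact hμ ((rsLaw_apply_eq_zero_iff hX).2 h)
    obtain ⟨y, rfl⟩ := exists_rsGraph_of_mem_rsSupport hX hmem
    refine Finset.mem_biUnion.2 ⟨y, Finset.mem_filter.2 ⟨Finset.mem_univ _, fun x => ?_⟩,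
      Finset.mem_filter.2 ⟨Finset.mem_univ _, (rsGraph_mem_rsSupport hX).1 hmem⟩⟩
    have := Finset.prod_ne_zero_iff.1 hprod (x, y x)
      (Finset.mem_map.2 ⟨x, Finset.mem_univ _, rfl⟩)
    exact ENNReal.coe_ne_zero.1 this
  calc _ ≤ (∑ y ∈ Y, (Finset.univ.filter fun π : {x // x ∈ X} → Equiv.Perm (ZMod q) =>
          (fun x => π x (y x)) ∈ rsCode d X).card) * q ^ k :=
        Nat.mul_le_mul_right _ ((Finset.card_le_card hsub).trans Finset.card_biUnion_le)
    _ = Y.card * (q ^ (d + 1) * Fintype.card ({x // x ∈ X} → Equiv.Perm (ZMod q))) := by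
        rw [Finset.sum_mul, Finset.sum_congr rfl fun y _ => ?_, Finset.sum_const, smul_eq_mul]
        rw [← card_rsCode (hd.trans_eq hX.symm), ← card_perm_mem_rsCode y, hX]
    _ ≤ _ := Nat.mul_le_mul_right _ hY

/-- The output field does not depend on `π`, and a field of size `t` supports a set of the random
support with probability at most `t ^ k * q ^ (d + 1) / q ^ k`. -/
theorem mul_pow_le_of_sparsifies (hd : d + 1 ≤ k) (hX : X.card = k) {t : ℕ} {ε δ : ℝ}
    (hε : ε < 1) (hδ : 0 < δ) (A : SparsificationScheme (RSGround X) (d + 1))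
    (h : ENNReal.ofReal δ ≤
      (PMF.uniformOfFintype ({x // x ∈ X} → Equiv.Perm (ZMod q))).toOuterMeasure
        {π | A.Sparsifies hd (rsLaw d hX π) t ε}) :
    δ * (1 - ε) * (q : ℝ) ^ k ≤ (t : ℝ) ^ k * (q : ℝ) ^ (d + 1) := by
  classical
  set P := {x // x ∈ X} → Equiv.Perm (ZMod q)
  set G : Finset P := Finset.univ.filter fun π => A.Sparsifies hd (rsLaw d hX π) t ε with hG
  have hcard : (Fintype.card P : ℝ≥0∞) ≠ 0 := by simp [Fintype.card_ne_zero]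
  have hδG : ENNReal.ofReal δ * Fintype.card P ≤ G.card := by
    rw [PMF.toOuterMeasure_uniformOfFintype_apply] at h
    rw [← ENNReal.le_div_iff_mul_le (Or.inl hcard) (Or.inl (by simp))]
    refine h.trans_eq ?_
    rw [hG, ← Fintype.card_subtype]
    congr!
  obtain ⟨π₀, hπ₀⟩ : G.Nonempty := by
    rw [Finset.nonempty_iff_ne_empty]
    intro h0
    rw [h0, Finset.card_empty, Nat.cast_zero, nonpos_iff_eq_zero, mul_eq_zero] at hδG
    exact hδG.elim (ENNReal.ofReal_pos.2 hδ).ne' hcard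
  set ρ := A.fieldLaw hd (rsLaw d hX π₀) with hρ
  have hlaw : ∀ π, A.fieldLaw hd (rsLaw d hX π) = ρ := fun π =>
    A.fieldLaw_congr hd (marginals_rsLaw_eq hX π π₀)
  have hmeas : ∀ π : P, MeasurableSet {w | ∑' S, fieldWeight (rsLaw d hX π) w S ≠ 0} := fun π =>
    (measurableSet_tsum_fieldWeight_eq_zero (rsLaw d hX π)).compl
  have hsum : G.card * ENNReal.ofReal (1 - ε) ≤
      ∫⁻ w, ((Finset.univ.filter fun π : P =>
        ∑' S, fieldWeight (rsLaw d hX π) w S ≠ 0).card : ℝ≥0∞) ∂ρ := by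
    calc G.card * ENNReal.ofReal (1 - ε) = ∑ _π ∈ G, ENNReal.ofReal (1 - ε) := by simp
      _ ≤ ∑ π ∈ G, ρ {w | ∑' S, fieldWeight (rsLaw d hX π) w S ≠ 0} := by
          refine Finset.sum_le_sum fun π hπ => ?_
          rw [← hlaw π]
          exact A.ofReal_one_sub_le_fieldLaw hd (Finset.mem_filter.1 hπ).2.2
      _ ≤ ∑ π, ρ {w | ∑' S, fieldWeight (rsLaw d hX π) w S ≠ 0} :=
          Finset.sum_le_sum_of_subset (Finset.subset_univ _)
      _ = ∫⁻ w, ∑ π : P, {w | ∑' S, fieldWeight (rsLaw d hX π) w S ≠ 0}.indicator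
            (fun _ => (1 : ℝ≥0∞)) w ∂ρ := by
          rw [lintegral_finsetSum _ fun π _ => measurable_const.indicator (hmeas π)]
          refine Finset.sum_congr rfl fun π _ => ?_
          rw [lintegral_indicator (hmeas π), setLIntegral_const, one_mul]
      _ = _ := by
          refine lintegral_congr fun w => ?_
          rw [Finset.card_filter, Nat.cast_sum]
          refine Finset.sum_congr rfl fun π _ => ?_
          simp [Set.indicator_apply]
  have hbound : G.card * ENNReal.ofReal (1 - ε) * (q : ℝ≥0∞) ^ k ≤
      (t : ℝ≥0∞) ^ k * ((q : ℝ≥0∞) ^ (d + 1) * Fintype.card P) := by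
    refine (mul_le_mul_left hsum _).trans ?_
    rw [← lintegral_mul_const' _ _ (by simp)]
    -- the law of the field is the same for all permutations, so one of them bounds its size
    have hae := (Finset.mem_filter.1 hπ₀).2.1
    refine (lintegral_mono_ae (g := fun _ =>
      (t : ℝ≥0∞) ^ k * ((q : ℝ≥0∞) ^ (d + 1) * Fintype.card P)) ?_).trans (by simp)
    filter_upwards [hae] with w hw
    exact_mod_cast card_perm_tsum_fieldWeight_ne_zero_le hd hX hw
  have hmul : ENNReal.ofReal δ * ENNReal.ofReal (1 - ε) * (q : ℝ≥0∞) ^ k * Fintype.card P ≤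
      (t : ℝ≥0∞) ^ k * (q : ℝ≥0∞) ^ (d + 1) * Fintype.card P := by
    calc _ = ENNReal.ofReal δ * Fintype.card P * ENNReal.ofReal (1 - ε) * (q : ℝ≥0∞) ^ k := by ring
      _ ≤ G.card * ENNReal.ofReal (1 - ε) * (q : ℝ≥0∞) ^ k := by gcongr
      _ ≤ _ := hbound.trans_eq (mul_assoc _ _ _).symm
  have := (ENNReal.mul_le_mul_iff_left hcard (by simp)).1 hmul
  have := ENNReal.toReal_mono (ENNReal.mul_ne_top (by simp) (by simp)) this
  simpa [ENNReal.toReal_ofReal hδ.le, ENNReal.toReal_ofReal (sub_pos.2 hε).le] using this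

end LowerBound

theorem rpow_mul_rpow_le_of_mul_pow_le {k D : ℕ} (hk : 1 ≤ k) {a q t : ℝ} (ha : 0 ≤ a)
    (hq : 0 < q) (ht : 0 ≤ t) (h : a * q ^ k ≤ t ^ k * q ^ D) :
    a ^ (k : ℝ)⁻¹ * q ^ (1 - (D : ℝ) / k) ≤ t := by
  have hk0 : (k : ℝ) ≠ 0 := by exact_mod_cast (by omega : k ≠ 0)
  refine le_of_pow_le_pow_left₀ (by omega : k ≠ 0) ht ?_
  have hexp : (1 - (D : ℝ) / k) * k = k - D := by field_simp
  rw [mul_pow, Real.rpow_inv_natCast_pow ha (by omega), ← Real.rpow_mul_natCast hq.le, hexp,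
    Real.rpow_sub hq, Real.rpow_natCast, Real.rpow_natCast, ← mul_div_assoc,
    div_le_iff₀ (by positivity)]
  exact h

theorem mainTheorem4 (k d : ℕ) (hd : d + 1 ≤ k) :
    -- entropic independence, for every choice of the permutations
    (∀ (q : ℕ) [Fact q.Prime] (X : Finset (ZMod q)) (hX : X.card = k)
        (π : {x // x ∈ X} → Equiv.Perm (ZMod q)),
      EntropicallyIndependent ((Nat.le_add_left 1 d).trans hd) (((d : ℝ) + 1) / k)
        (rsLaw d hX π)) ∧
    -- lower bound for schemes with access to the marginals of all orders up to `d + 1`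
    (∀ ε δ : ℝ, ε < 1 → 0 < δ → ∃ c : ℝ, 0 < c ∧
      ∀ (q : ℕ) [Fact q.Prime] (X : Finset (ZMod q)) (hX : X.card = k) (t : ℕ)
        (A : SparsificationScheme (RSGround X) (d + 1)),
        ENNReal.ofReal δ ≤
            (PMF.uniformOfFintype ({x // x ∈ X} → Equiv.Perm (ZMod q))).toOuterMeasure
              {π | A.Sparsifies hd (rsLaw d hX π) t ε} →
          c * (Fintype.card (RSGround X) : ℝ) ^ (1 - ((d : ℝ) + 1) / k) ≤ t) := by
  have hk : 1 ≤ k := (Nat.le_add_left 1 d).trans hd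
  have hk0 : (0 : ℝ) < k := by exact_mod_cast hk
  refine ⟨fun q _ X hX π => entropicallyIndependent_rsLaw hd hk hX π, fun ε δ hε hδ => ?_⟩
  have ha : 0 < δ * (1 - ε) := mul_pos hδ (sub_pos.2 hε)
  -- the second factor absorbs the difference between `n = k * q` and `q`
  refine ⟨(δ * (1 - ε)) ^ (k : ℝ)⁻¹ / (k : ℝ) ^ (1 - ((d : ℝ) + 1) / k), by positivity,
    fun q _ X hX t A h => ?_⟩
  have hq0 : (0 : ℝ) < q := by exact_mod_cast (Fact.out : q.Prime).pos
  have hcard : (Fintype.card (RSGround X) : ℝ) = k * q := by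
    rw [Fintype.card_prod, Fintype.card_coe, hX, ZMod.card, Nat.cast_mul]
  have key := rpow_mul_rpow_le_of_mul_pow_le hk ha.le hq0 (Nat.cast_nonneg t)
    (mul_pow_le_of_sparsifies hd hX hε hδ A h)
  rw [hcard, Real.mul_rpow hk0.le hq0.le, ← mul_assoc, div_mul_cancel₀ _ (by positivity)]
  exact_mod_cast key
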